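/- Let $(R,\mathfrak m,k)$ be a commutative Noetherian local ring of depth $t\ge 3$. For $n\ge 0$ let $\Omega^n_R k$ denote the $n$-th syzygy of the residue field $k$ in a minimal $R$-free resolution of $k$, and for an $R$-module $M$ let $M^*=\operatorname{Hom}_R(M,R)$; call $M$ reflexive if the natural biduality map $M\to M^{**}$ is an isomorphism, and self-dual if $M\cong M^*$ as $R$-modules. Then $\Omega^i_R k$ is reflexive for every integer $i$ with $2\le i\le t-1$. If, moreover, $\Omega^i_R k$ is self-dual for some integer $i$ with $2\le i\le t-1$, then $R$ is regular, $t$ is odd, and $t=2i-1$. -/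

import Mathlib

universe u

open IsLocalRing

/-- The depth of a local ring `R`: the supremum of the lengths of the `R`-regular sequences whose
members lie in the maximal ideal. -/
noncomputable def IsLocalRing.depth (R : Type u) [CommRing R] [IsLocalRing R] : ℕ∞ :=
  ⨆ (rs : List R) (_ : (∀ r ∈ rs, r ∈ maximalIdeal R) ∧ RingTheory.Sequence.IsRegular R rs),
    (rs.length : ℕ∞)

/-- An `R`-module `M` is self-dual if there is some `R`-linear isomorphism `M ≅ Hom_R(M, R)`. -/
def Module.IsSelfDual (R : Type u) [CommRing R] (M : Type u) [AddCommGroup M] [Module R M] : Prop :=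
  Nonempty (M ≃ₗ[R] Module.Dual R M)

/-- A minimal free resolution
`⋯ → R^(rank 2) → R^(rank 1) → R^(rank 0) → M → 0` by free modules of finite rank
of a module `M` over a local ring `(R, 𝔪)`. The map `d n` goes from degree `n + 1` to degree `n`;
minimality says that its image lies in `𝔪 R^(rank n)`, that is, all coordinates of all values
are in `𝔪`. -/
structure MinimalFreeResolution (R : Type u) [CommRing R] [IsLocalRing R]
    (M : Type u) [AddCommGroup M] [Module R M] where
  /-- the ranks of the free modules (the Betti numbers of `M`) -/
  rank : ℕ → ℕ
  /-- the differentials -/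
  d : ∀ n, (Fin (rank (n + 1)) → R) →ₗ[R] (Fin (rank n) → R)
  /-- the augmentation -/
  ε : (Fin (rank 0) → R) →ₗ[R] M
  surjective_ε : Function.Surjective ε
  exact_zero : Function.Exact (d 0) ε
  exact_succ : ∀ n, Function.Exact (d (n + 1)) (d n)
  minimal : ∀ n x j, d n x j ∈ maximalIdeal R

namespace MinimalFreeResolution

/-- The `n`-th syzygy of `M` in a minimal free resolution: `Ω⁰ M = M`, and
`Ωⁿ⁺¹ M` is the image of the differential from degree `n + 1` to degree `n`. -/
def syzygy {R : Type u} [CommRing R] [IsLocalRing R] {M : Type u} [AddCommGroup M] [Module R M]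
    (F : MinimalFreeResolution R M) : ℕ → ModuleCat.{u} R
  | 0 => ModuleCat.of R M
  | n + 1 => ModuleCat.of R (LinearMap.range (F.d n))

open TensorProduct in
theorem exists_minimal_cover (R : Type u) [CommRing R] [IsLocalRing R] (M : Type u)
    [AddCommGroup M] [Module R M] [Module.Finite R M] :
    ∃ (n : ℕ) (f : (Fin n → R) →ₗ[R] M), Function.Surjective f ∧
      ∀ x ∈ LinearMap.ker f, ∀ j, x j ∈ maximalIdeal R := by
  let b := Module.finBasis (ResidueField R) (ResidueField R ⊗[R] M)
  have hs := TensorProduct.mk_surjective R M (ResidueField R) residue_surjective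
  choose v hv using fun i => hs (b i)
  refine ⟨_, Fintype.linearCombination R v, ?_, ?_⟩
  · rw [← LinearMap.range_eq_top, Fintype.range_linearCombination]
    exact IsLocalRing.span_eq_top_of_tmul_eq_basis v b hv
  · intro x hx j
    have h : ∑ i, residue R (x i) • b i = 0 := by
      have := congrArg (TensorProduct.mk R (ResidueField R) M 1) (LinearMap.mem_ker.mp hx)
      rw [Fintype.linearCombination_apply, map_sum, map_zero] at this
      rw [← this]
      refine Finset.sum_congr rfl fun i _ => ?_
      rw [map_smul, hv]
      exact algebraMap_smul (ResidueField R) (x i) (b i)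
    exact (residue_eq_zero_iff _).mp (Fintype.linearIndependent_iff.mp b.linearIndependent _ h j)

/-- Every finitely generated module over a Noetherian local ring has a minimal free resolution. -/
theorem nonempty (R : Type u) [CommRing R] [IsLocalRing R] [IsNoetherianRing R] (M : Type u)
    [AddCommGroup M] [Module R M] [Module.Finite R M] : Nonempty (MinimalFreeResolution R M) := by
  have key : ∀ s : Σ n : ℕ, Submodule R (Fin n → R),
      ∃ (p : ℕ) (f : (Fin p → R) →ₗ[R] (Fin s.1 → R)), LinearMap.range f = s.2 ∧
        ∀ x ∈ LinearMap.ker f, ∀ j, x j ∈ maximalIdeal R := by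
    rintro ⟨n, N⟩
    obtain ⟨p, f, hf, hk⟩ := exists_minimal_cover R N
    refine ⟨p, N.subtype ∘ₗ f, ?_, fun x hx => hk x ?_⟩
    · rw [LinearMap.range_comp, LinearMap.range_eq_top.mpr hf, Submodule.map_top,
        Submodule.range_subtype]
    · simpa using hx
  choose p f hf hk using key
  obtain ⟨n₀, ε, hε, hε'⟩ := exists_minimal_cover R M
  let st : ℕ → Σ n : ℕ, Submodule R (Fin n → R) := fun n =>
    Nat.rec ⟨n₀, LinearMap.ker ε⟩ (fun _ s => ⟨p s, LinearMap.ker (f s)⟩) n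
  have hst : ∀ n, ∀ x ∈ (st n).2, ∀ j, x j ∈ maximalIdeal R := by
    intro n
    cases n with
    | zero => exact hε'
    | succ n => exact hk (st n)
  exact ⟨{
    rank := fun n => (st n).1
    d := fun n => f (st n)
    ε := ε
    surjective_ε := hε
    exact_zero := LinearMap.exact_iff.mpr (hf (st 0)).symm
    exact_succ := fun n => LinearMap.exact_iff.mpr (hf (st (n + 1))).symm
    minimal := fun n x => hst n _ (hf (st n) ▸ LinearMap.mem_range_self _ x) }⟩

end MinimalFreeResolution

/-! Write $F_\bullet$ for the resolution and $i=m+1$. Since $R$ has depth $t$,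
$\operatorname{Ext}^j(k,R)=0$ for $j<t$. Dimension shifting then makes functionals on
$\Omega^{m+1}k\subseteq F_m$ extend to $F_m$ whenever $m+1<t$ (`exists_extension`), and the dual
complex $0\to F_0^*\to F_1^*\to\cdots$ is exact below degree $t$. Reflexivity follows by comparing
$\Omega^i k$ with the reflexive free module around it.

The dual of $\Omega^{m+1}k$ is the image of $F_m^*\to F_{m+1}^*$, so it has the finite minimal
resolution $0\to F_0^*\to\cdots\to F_m^*$. If $\Omega^{m+1}k$ is self-dual, uniqueness of minimal
resolutions gives $\Omega^{2m+1}k\cong F_0^*$, free and nonzero (`d_injective_of_isSelfDual`). Thus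
$\operatorname{pd} k=2m+1=2i-1$.

Finite projective dimension of $k$ forces $\mathfrak m$ to be generated by a regular sequence
(`exists_isWeaklyRegular_ofList_eq_maximalIdeal`), so $R$ is regular. The length of that sequence is
$\operatorname{pd} k$ and is at most $t$; conversely $t\le\operatorname{pd} k$, because the
resolution is minimal and its dual is exact below $t$. Hence $t=2i-1$. -/

open CategoryTheory Abelian Module

/-- A linear map factors through a surjection if it kills the kernel of the surjection. -/
lemma LinearMap.exists_comp_eq_of_ker_le {R M N P : Type*} [CommRing R] [AddCommGroup M]
    [Module R M] [AddCommGroup N] [Module R N] [AddCommGroup P] [Module R P] {f : M →ₗ[R] N}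
    {g : M →ₗ[R] P} (hf : Function.Surjective f) (h : LinearMap.ker f ≤ LinearMap.ker g) :
    ∃ φ : N →ₗ[R] P, φ ∘ₗ f = g := by
  refine ⟨(LinearMap.ker f).liftQ g h ∘ₗ (f.quotKerEquivOfSurjective hf).symm.toLinearMap, ?_⟩
  ext x
  have : (f.quotKerEquivOfSurjective hf).symm (f x) = (LinearMap.ker f).mkQ x :=
    (LinearEquiv.symm_apply_eq _).mpr rfl
  simp [this]

/-- Dimension shifting for `Ext` along the kernel of a surjection from a projective module. -/
lemma LinearMap.subsingleton_ext_ker {R : Type u} [CommRing R] {P M : Type u} [AddCommGroup P]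
    [Module R P] [AddCommGroup M] [Module R M] [Module.Projective R P] {f : P →ₗ[R] M}
    (hf : Function.Surjective f) (N : ModuleCat.{u} R) {j : ℕ}
    (h : Subsingleton (Ext (ModuleCat.of R M) N (j + 2))) :
    Subsingleton (Ext (ModuleCat.of R (LinearMap.ker f)) N (j + 1)) := by
  have hS := LinearMap.shortExact_shortComplexKer hf
  have : CategoryTheory.Projective f.shortComplexKer.X₂ :=
    (IsProjective.iff_projective (ModuleCat.of R P)).mp inferInstance
  refine subsingleton_of_forall_eq 0 fun x ↦ ?_
  obtain ⟨y, rfl⟩ := Ext.contravariant_sequence_exact₁ hS N x (add_comm 1 (j + 1))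
    (h.elim _ _)
  rw [Ext.eq_zero_of_projective y, Ext.comp_zero]

/-- If `Ext¹(M, N) = 0`, then maps to `N` extend from the kernel of a surjection onto `M`. -/
lemma LinearMap.exists_extension_of_subsingleton_ext {R : Type u} [CommRing R] {P M N : Type u}
    [AddCommGroup P] [Module R P] [AddCommGroup M] [Module R M] [AddCommGroup N] [Module R N]
    {f : P →ₗ[R] M} (hf : Function.Surjective f)
    (h : Subsingleton (Ext (ModuleCat.of R M) (ModuleCat.of R N) 1))
    (φ : LinearMap.ker f →ₗ[R] N) : ∃ ψ : P →ₗ[R] N, ∀ x, ψ x.1 = φ x := by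
  have hS := LinearMap.shortExact_shortComplexKer hf
  obtain ⟨y, hy⟩ := Ext.contravariant_sequence_exact₁ hS (ModuleCat.of R N)
    (Ext.mk₀ (ModuleCat.ofHom φ)) (add_zero 1) (h.elim _ _)
  obtain ⟨ψ, rfl⟩ := Ext.homEquiv₀.symm.surjective y
  simp only [Ext.homEquiv₀_symm_apply, Ext.mk₀_comp_mk₀] at hy
  have := (Ext.mk₀_bijective _ _).1 hy
  exact ⟨ψ.hom, fun x ↦ congr($(this).hom x)⟩

/-! ### Depth and vanishing of Ext. -/

namespace IsLocalRing

/-- In a local ring of depth `t`, there is a regular sequence of length at least `t`. -/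
lemma exists_isRegular_of_le_depth {R : Type u} [CommRing R] [IsLocalRing R] {t : ℕ}
    (ht : (t : ℕ∞) ≤ depth R) : ∃ rs : List R, (∀ r ∈ rs, r ∈ maximalIdeal R) ∧
      RingTheory.Sequence.IsRegular R rs ∧ t ≤ rs.length := by
  by_contra! h
  have h0 : t ≠ 0 := by
    rintro rfl
    exact absurd (h [] (by simp) (RingTheory.Sequence.IsRegular.nil R R)) (by simp)
  have : depth R ≤ (t - 1 : ℕ) :=
    iSup₂_le fun rs hrs ↦ by exact_mod_cast Nat.le_sub_one_of_lt (h rs hrs.1 hrs.2)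
  have := ht.trans this
  norm_cast at this
  omega

lemma annihilator_residueField (R : Type*) [CommRing R] [IsLocalRing R] :
    Module.annihilator R (ResidueField R) = maximalIdeal R :=
  Ideal.annihilator_quotient

/-- Rees: a regular sequence in $\mathfrak m$ longer than $j$ kills $\operatorname{Ext}^j$ out of a
module supported at the closed point. -/
lemma subsingleton_ext_residueField {R : Type u} [CommRing R] [IsLocalRing R] [IsNoetherianRing R]
    {t : ℕ} (ht : (t : ℕ∞) ≤ depth R) {j : ℕ} (hj : j < t) :
    Subsingleton (Ext (ModuleCat.of R (ResidueField R)) (ModuleCat.of R R) j) := by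
  obtain ⟨rs, hrs, hreg, hlen⟩ := exists_isRegular_of_le_depth ht
  refine ModuleCat.subsingleton_ext_of_exists_isRegular (maximalIdeal R) _ ?_ _ ?_ rs hrs hreg j
    (hj.trans_le hlen)
  · rw [Module.support_eq_zeroLocus, annihilator_residueField]
  · simpa [lt_top_iff_ne_top] using! Ideal.IsPrime.ne_top'

end IsLocalRing

/-! ### Syzygies, extension of functionals, reflexivity. -/

namespace MinimalFreeResolution

variable {R : Type u} [CommRing R] [IsLocalRing R] {M : Type u} [AddCommGroup M] [Module R M]
  (F : MinimalFreeResolution R M)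

/-- The minimal cover of the `n`-th syzygy by the `n`-th free module. -/
def cover : ∀ n, (Fin (F.rank n) → R) →ₗ[R] F.syzygy n
  | 0 => F.ε
  | n + 1 => (F.d n).rangeRestrict

lemma cover_surjective : ∀ n, Function.Surjective (F.cover n)
  | 0 => F.surjective_ε
  | n + 1 => (F.d n).surjective_rangeRestrict

lemma ker_cover : ∀ n, LinearMap.ker (F.cover n) = LinearMap.range (F.d n)
  | 0 => LinearMap.exact_iff.mp F.exact_zero
  | n + 1 => (LinearMap.ker_rangeRestrict _).trans (LinearMap.exact_iff.mp (F.exact_succ n))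

/-- The kernel of the `n`-th cover is the next syzygy. -/
def kerCoverEquiv (n : ℕ) : LinearMap.ker (F.cover n) ≃ₗ[R] F.syzygy (n + 1) :=
  LinearEquiv.ofEq _ _ (F.ker_cover n)

/-- Shifting $m$ times identifies the vanishing with that of $\operatorname{Ext}^{m+j+1}(M,N)$. The
shift needs positive Ext degree, hence $j+1$. -/
lemma subsingleton_ext_syzygy {N : ModuleCat.{u} R} {t : ℕ}
    (h : ∀ j < t, Subsingleton (Ext (ModuleCat.of R M) N j)) (m j : ℕ) (hj : m + j + 1 < t) :
    Subsingleton (Ext (F.syzygy m) N (j + 1)) := by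
  induction m generalizing j with
  | zero => exact h _ (by omega)
  | succ m ih =>
    have := LinearMap.subsingleton_ext_ker (F.cover_surjective m) N (ih (j + 1) (by omega))
    rwa [F.ker_cover m] at this

section Ext

variable {N : Type u} [AddCommGroup N] [Module R N] {t : ℕ}
  (h : ∀ j < t, Subsingleton (Ext (ModuleCat.of R M) (ModuleCat.of R N) j))
include h

/-- Maps from the syzygies extend to the free modules containing them. -/
lemma exists_extension {m : ℕ} (hm : m + 1 < t) (φ : LinearMap.range (F.d m) →ₗ[R] N) :
    ∃ ψ : (Fin (F.rank m) → R) →ₗ[R] N, ∀ x, ψ x.1 = φ x := by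
  have := F.subsingleton_ext_syzygy h m 0 hm
  obtain ⟨ψ, hψ⟩ := LinearMap.exists_extension_of_subsingleton_ext (F.cover_surjective m) this
    (φ ∘ₗ (LinearEquiv.ofEq _ _ (F.ker_cover m)).toLinearMap)
  exact ⟨ψ, fun x ↦ hψ ⟨x.1, (F.ker_cover m).symm ▸ x.2⟩⟩

/-- Exactness of the dual complex in positive degrees below `t`. -/
lemma exists_eq_comp_d {m : ℕ} (hm : m + 1 < t) (f : (Fin (F.rank (m + 1)) → R) →ₗ[R] N)
    (hf : f ∘ₗ F.d (m + 1) = 0) : ∃ g : (Fin (F.rank m) → R) →ₗ[R] N, g ∘ₗ F.d m = f := by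
  have hle : LinearMap.ker (F.d m) ≤ LinearMap.ker f := by
    rw [LinearMap.exact_iff.mp (F.exact_succ m)]
    rintro _ ⟨x, rfl⟩
    exact congr($hf x)
  obtain ⟨φ, hφ⟩ := LinearMap.exists_comp_eq_of_ker_le (F.d m).surjective_rangeRestrict
    ((LinearMap.ker_rangeRestrict _).trans_le hle)
  obtain ⟨g, hg⟩ := F.exists_extension h hm φ
  exact ⟨g, LinearMap.ext fun x ↦ (hg ⟨F.d m x, _⟩).trans congr($hφ x)⟩

/-- Exactness of the dual complex in degree `0`. -/
lemma eq_zero_of_comp_d_eq_zero (ht : 0 < t) (f : (Fin (F.rank 0) → R) →ₗ[R] N)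
    (hf : f ∘ₗ F.d 0 = 0) : f = 0 := by
  have hle : LinearMap.ker F.ε ≤ LinearMap.ker f := by
    rw [LinearMap.exact_iff.mp F.exact_zero]
    rintro _ ⟨x, rfl⟩
    exact congr($hf x)
  have : Subsingleton (M →ₗ[R] N) :=
    (Ext.addEquiv₀.trans ModuleCat.homAddEquiv).subsingleton_congr.mp (h 0 ht)
  obtain ⟨g, rfl⟩ := LinearMap.exists_comp_eq_of_ker_le F.surjective_ε hle
  rw [Subsingleton.elim g 0, LinearMap.zero_comp]

end Ext

/-- A syzygy is reflexive if its functionals extend to the ambient free module. -/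
lemma isReflexive_syzygy {t : ℕ}
    (h : ∀ j < t, Subsingleton (Ext (ModuleCat.of R M) (ModuleCat.of R R) j)) {b : ℕ}
    (hb : b + 2 < t) : Module.IsReflexive R (F.syzygy (b + 2)) := by
  change Module.IsReflexive R (LinearMap.range (F.d (b + 1)))
  have hker := LinearMap.exact_iff.mp (F.exact_succ b)
  refine ⟨fun x y hxy ↦ Subtype.ext (funext fun j ↦ ?_), fun Ψ ↦ ?_⟩
  · have := LinearMap.congr_fun hxy
      (LinearMap.proj j ∘ₗ (LinearMap.range (F.d (b + 1))).subtype)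
    exact this
  · let res := (LinearMap.range (F.d (b + 1))).subtype.dualMap
    -- Pulled back to functionals on the free module, $\Psi$ is evaluation at some $v$. The
    -- coordinates of `F.d b` restrict to zero on the syzygy, so $v$ lies in the kernel of `F.d b`,
    -- which is the syzygy itself.
    obtain ⟨v, hv⟩ := (bijective_dual_eval R (Fin (F.rank (b + 1)) → R)).2 (Ψ ∘ₗ res)
    have hv' (g : Dual R (Fin (F.rank (b + 1)) → R)) : g v = Ψ (res g) := congr($hv g)
    have hmem : v ∈ LinearMap.range (F.d (b + 1)) := by
      rw [← hker, LinearMap.mem_ker]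
      funext j
      refine (hv' (LinearMap.proj j ∘ₗ F.d b)).trans ?_
      have : res (LinearMap.proj j ∘ₗ F.d b) = 0 := by
        ext ⟨x, hx⟩
        rw [← hker, LinearMap.mem_ker] at hx
        exact congr_fun hx j
      rw [this, map_zero, Pi.zero_apply]
    refine ⟨⟨v, hmem⟩, LinearMap.ext fun φ ↦ ?_⟩
    obtain ⟨ψ, hψ⟩ := F.exists_extension h hb φ
    have : res ψ = φ := LinearMap.ext hψ
    rw [← this, ← hv']
    rfl

end MinimalFreeResolution

/-! ### Uniqueness of minimal covers. -/

namespace IsLocalRing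

variable {R : Type*} [CommRing R] [IsLocalRing R]

/-- Nakayama gives surjectivity, and a surjective endomorphism of a finite module is injective. -/
lemma bijective_of_sub_id_mem_smul_top {P : Type*} [AddCommGroup P] [Module R P]
    [Module.Finite R P] {φ : P →ₗ[R] P}
    (h : ∀ x, φ x - x ∈ maximalIdeal R • (⊤ : Submodule R P)) : Function.Bijective φ := by
  have hsurj : Function.Surjective φ := by
    rw [← LinearMap.range_eq_top, eq_top_iff]
    refine Submodule.le_of_le_smul_of_le_jacobson_bot Module.Finite.fg_top
      (maximalIdeal_le_jacobson _) fun x _ ↦ ?_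
    rw [show x = φ x - (φ x - x) by abel]
    exact Submodule.sub_mem _ (Submodule.mem_sup_left ⟨x, rfl⟩) (Submodule.mem_sup_right (h x))
  exact ⟨OrzechProperty.injective_of_surjective_endomorphism φ hsurj, hsurj⟩

variable {P Q M N : Type*} [AddCommGroup P] [Module R P] [AddCommGroup Q] [Module R Q]
  [AddCommGroup M] [Module R M] [AddCommGroup N] [Module R N] [Module.Finite R P]
  [Module.Projective R P] [Module.Finite R Q] [Module.Projective R Q]
  {f : P →ₗ[R] M} {g : Q →ₗ[R] N}

/-- Minimal covers of isomorphic modules are isomorphic. -/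
lemma exists_equiv_of_minimal_covers (hf : Function.Surjective f) (hg : Function.Surjective g)
    (hf' : LinearMap.ker f ≤ maximalIdeal R • ⊤) (hg' : LinearMap.ker g ≤ maximalIdeal R • ⊤)
    (e : M ≃ₗ[R] N) : ∃ φ : P ≃ₗ[R] Q, ∀ x, g (φ x) = e (f x) := by
  obtain ⟨φ, hφ⟩ := Module.projective_lifting_property g (e.toLinearMap ∘ₗ f) hg
  obtain ⟨ψ, hψ⟩ := Module.projective_lifting_property f (e.symm.toLinearMap ∘ₗ g) hf
  have hφ' (x) : g (φ x) = e (f x) := congr($hφ x)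
  have hψ' (x) : f (ψ x) = e.symm (g x) := congr($hψ x)
  have h₁ : Function.Bijective (ψ ∘ₗ φ) :=
    bijective_of_sub_id_mem_smul_top fun x ↦ hf' (by simp [hφ', hψ'])
  have h₂ : Function.Bijective (φ ∘ₗ ψ) :=
    bijective_of_sub_id_mem_smul_top fun x ↦ hg' (by simp [hφ', hψ'])
  exact ⟨.ofBijective φ ⟨.of_comp h₁.1, .of_comp h₂.2⟩, hφ'⟩

lemma nonempty_ker_equiv_of_minimal_covers (hf : Function.Surjective f)
    (hg : Function.Surjective g) (hf' : LinearMap.ker f ≤ maximalIdeal R • ⊤)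
    (hg' : LinearMap.ker g ≤ maximalIdeal R • ⊤) (e : M ≃ₗ[R] N) :
    Nonempty (LinearMap.ker f ≃ₗ[R] LinearMap.ker g) := by
  obtain ⟨φ, hφ⟩ := exists_equiv_of_minimal_covers hf hg hf' hg' e
  refine ⟨φ.ofSubmodules _ _ (Submodule.ext fun y ↦ ?_)⟩
  rw [Submodule.map_equiv_eq_comap_symm, Submodule.mem_comap, LinearMap.mem_ker, LinearMap.mem_ker]
  have := hφ (φ.symm y)
  rw [φ.apply_symm_apply] at this
  simp [this]

end IsLocalRing

lemma Module.Basis.mem_ideal_smul_top {R M ι : Type*} [CommRing R] [AddCommGroup M] [Module R M]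
    [Finite ι] (b : Module.Basis ι R M) {I : Ideal R} {x : M} (h : ∀ i, b.repr x i ∈ I) :
    x ∈ I • (⊤ : Submodule R M) := by
  have := Fintype.ofFinite ι
  rw [← b.sum_repr x]
  exact Submodule.sum_mem _ fun i _ ↦ Submodule.smul_mem_smul (h i) trivial

lemma LinearMap.exists_eq_dotProduct {R : Type*} [CommRing R] {n : ℕ}
    (f : (Fin n → R) →ₗ[R] R) : ∃ v, ∀ x, f x = v ⬝ᵥ x :=
  let ⟨v, hv⟩ := (dotProductEquiv R (Fin n)).surjective f
  ⟨v, fun _ ↦ hv ▸ rfl⟩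

/-! ### The dual complex and self-dual syzygies. -/

namespace MinimalFreeResolution

variable {R : Type u} [CommRing R] [IsLocalRing R] {M : Type u} [AddCommGroup M] [Module R M]
  (F : MinimalFreeResolution R M)

lemma ker_cover_le (n : ℕ) : LinearMap.ker (F.cover n) ≤ maximalIdeal R • ⊤ := by
  rw [F.ker_cover n]
  rintro _ ⟨x, rfl⟩
  exact (Pi.basisFun R _).mem_ideal_smul_top fun j ↦ by simpa using F.minimal n x j

/-- The `m`-th differential of the dual complex, in coordinates. -/
def transpose (m : ℕ) : (Fin (F.rank m) → R) →ₗ[R] (Fin (F.rank (m + 1)) → R) :=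
  (LinearMap.toMatrix' (F.d m)).vecMulLinear

lemma transpose_dotProduct (m : ℕ) (v x) : F.transpose m v ⬝ᵥ x = v ⬝ᵥ F.d m x := by
  rw [transpose, Matrix.vecMulLinear_apply, ← Matrix.dotProduct_mulVec,
    LinearMap.toMatrix'_mulVec]

lemma transpose_apply (m : ℕ) (v j) : F.transpose m v j = v ⬝ᵥ F.d m (Pi.single j 1) := by
  rw [← transpose_dotProduct, dotProduct_single_one]

lemma dotProduct_d_mem (m : ℕ) (v x) : v ⬝ᵥ F.d m x ∈ maximalIdeal R :=
  Ideal.sum_mem _ fun j _ ↦ Ideal.mul_mem_left _ _ (F.minimal m x j)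

lemma range_transpose_le (m : ℕ) : LinearMap.range (F.transpose m) ≤ maximalIdeal R • ⊤ := by
  rintro _ ⟨v, rfl⟩
  refine (Pi.basisFun R _).mem_ideal_smul_top fun j ↦ ?_
  rw [Pi.basisFun_repr, transpose_apply]
  exact F.dotProduct_d_mem m v _

section Ext

variable {t : ℕ} (h : ∀ j < t, Subsingleton (Ext (ModuleCat.of R M) (ModuleCat.of R R) j))
include h

lemma ker_transpose {m : ℕ} (hm : m + 1 < t) :
    LinearMap.ker (F.transpose (m + 1)) = LinearMap.range (F.transpose m) := by
  refine le_antisymm (fun w hw ↦ ?_) ?_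
  · obtain ⟨g, hg⟩ := F.exists_eq_comp_d h hm (dotProductBilin R R w) (LinearMap.ext fun x ↦ by
      simpa [LinearMap.mem_ker.mp hw] using (F.transpose_dotProduct (m + 1) w x).symm)
    obtain ⟨v, hv⟩ := LinearMap.exists_eq_dotProduct g
    refine ⟨v, dotProduct_eq _ _ fun x ↦ ?_⟩
    rw [transpose_dotProduct, ← hv]
    exact congr($hg x)
  · rintro _ ⟨v, rfl⟩
    refine dotProduct_eq _ _ fun x ↦ ?_
    rw [transpose_dotProduct, transpose_dotProduct, (F.exact_succ m).apply_apply_eq_zero,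
      dotProduct_zero, zero_dotProduct]

lemma injective_transpose_zero (ht : 0 < t) : Function.Injective (F.transpose 0) := by
  refine (injective_iff_map_eq_zero _).mpr fun v hv ↦ dotProduct_eq _ _ fun x ↦ ?_
  have := F.eq_zero_of_comp_d_eq_zero h ht (dotProductBilin R R v) (LinearMap.ext fun x ↦ by
    simpa [hv] using (F.transpose_dotProduct 0 v x).symm)
  simpa using congr($this x)

/-- Both modules have minimal covers, by $F_n$ and by $F_{m+1}^*$, so the isomorphism passes to the
kernels: one step up the resolution matches one step down its dual. -/
lemma nonempty_syzygy_equiv_step {n m : ℕ} (hm : m + 1 < t)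
    (e : F.syzygy n ≃ₗ[R] LinearMap.range (F.transpose (m + 1))) :
    Nonempty (F.syzygy (n + 1) ≃ₗ[R] LinearMap.range (F.transpose m)) := by
  have hk : LinearMap.ker (F.transpose (m + 1)).rangeRestrict = LinearMap.range (F.transpose m) :=
    (LinearMap.ker_rangeRestrict _).trans (F.ker_transpose h hm)
  obtain ⟨e'⟩ := nonempty_ker_equiv_of_minimal_covers (F.cover_surjective n)
    (F.transpose (m + 1)).surjective_rangeRestrict (F.ker_cover_le n)
    (hk.trans_le (F.range_transpose_le m)) e
  exact ⟨(F.kerCoverEquiv n).symm ≪≫ₗ e' ≪≫ₗ LinearEquiv.ofEq _ _ hk⟩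

/-- The dual of the `(m + 1)`-st syzygy is the image of a dual differential. -/
lemma nonempty_dual_syzygy_equiv {m : ℕ} (hm : m + 1 < t) :
    Nonempty (Dual R (F.syzygy (m + 1)) ≃ₗ[R] LinearMap.range (F.transpose m)) := by
  change Nonempty (Dual R (LinearMap.range (F.d m)) ≃ₗ[R] _)
  let ι : Dual R (LinearMap.range (F.d m)) →ₗ[R] (Fin (F.rank (m + 1)) → R) :=
    LinearMap.pi fun j ↦ Dual.eval R _ ((F.d m).rangeRestrict (Pi.single j 1))
  have hι' (φ j) : ι φ j = φ ((F.d m).rangeRestrict (Pi.single j 1)) := rfl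
  have hι : Function.Injective ι := (injective_iff_map_eq_zero _).mpr fun φ hφ ↦ by
    have : φ ∘ₗ (F.d m).rangeRestrict = 0 := LinearMap.pi_ext' fun j ↦ LinearMap.ext_ring
      (congr_fun hφ j)
    exact LinearMap.ext fun x ↦ by
      obtain ⟨y, rfl⟩ := (F.d m).surjective_rangeRestrict x
      exact congr($this y)
  refine ⟨LinearEquiv.ofInjective ι hι ≪≫ₗ LinearEquiv.ofEq _ _ (le_antisymm ?_ ?_)⟩
  · rintro _ ⟨φ, rfl⟩
    obtain ⟨ψ, hψ⟩ := F.exists_extension h hm φ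
    obtain ⟨v, hv⟩ := LinearMap.exists_eq_dotProduct ψ
    refine ⟨v, funext fun j ↦ ?_⟩
    rw [transpose_apply, ← hv, hι', ← hψ]
    rfl
  · rintro _ ⟨v, rfl⟩
    refine ⟨dotProductBilin R R v ∘ₗ (LinearMap.range (F.d m)).subtype, funext fun j ↦ ?_⟩
    rw [transpose_apply, hι']
    rfl

lemma nonempty_syzygy_equiv_of_isSelfDual {m : ℕ} (hm : m + 1 < t)
    (hd : Module.IsSelfDual R (F.syzygy (m + 1))) (j : ℕ) (hj : j ≤ m) :
    Nonempty (F.syzygy (m + 1 + j) ≃ₗ[R] LinearMap.range (F.transpose (m - j))) := by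
  induction j with
  | zero =>
    obtain ⟨e⟩ := hd
    obtain ⟨e'⟩ := F.nonempty_dual_syzygy_equiv h hm
    exact ⟨e ≪≫ₗ e'⟩
  | succ j ih =>
    obtain ⟨e⟩ := ih (by omega)
    rw [show m - j = m - (j + 1) + 1 by omega] at e
    exact F.nonempty_syzygy_equiv_step h (by omega) e

/-- If a syzygy is self-dual, then the resolution is finite, and its length is determined. -/
lemma d_injective_of_isSelfDual [Nontrivial M] {m : ℕ} (hm : m + 1 < t)
    (hd : Module.IsSelfDual R (F.syzygy (m + 1))) :
    Function.Injective (F.d (2 * m)) ∧ F.rank (2 * m + 1) ≠ 0 := by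
  obtain ⟨e⟩ := F.nonempty_syzygy_equiv_of_isSelfDual h hm hd m le_rfl
  rw [Nat.sub_self, show m + 1 + m = 2 * m + 1 by omega] at e
  have hinj := F.injective_transpose_zero h (by omega)
  have hk : LinearMap.ker (F.transpose 0).rangeRestrict = ⊥ :=
    (LinearMap.ker_rangeRestrict _).trans (LinearMap.ker_eq_bot.mpr hinj)
  -- The injective `transpose 0` is a minimal cover of its image with zero kernel; comparison makes
  -- the cover of $\Omega^{2m+1}$ injective and gives $F_{2m+1}\cong F_0^*$.
  obtain ⟨φ, hφ⟩ := exists_equiv_of_minimal_covers (F.cover_surjective (2 * m + 1))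
    (F.transpose 0).surjective_rangeRestrict (F.ker_cover_le _) (hk.trans_le bot_le) e
  constructor
  · refine (injective_iff_map_eq_zero _).mpr fun x hx ↦ ?_
    have hx' : F.cover (2 * m + 1) x = 0 := Subtype.ext hx
    have : φ x ∈ LinearMap.ker (F.transpose 0).rangeRestrict := by
      rw [LinearMap.mem_ker, hφ, hx', map_zero]
    rwa [hk, Submodule.mem_bot, LinearEquiv.map_eq_zero_iff] at this
  · intro h0
    have : IsEmpty (Fin (F.rank (2 * m + 1))) := by rw [h0]; infer_instance
    have : Subsingleton (Fin (F.rank 0) → R) := φ.symm.toEquiv.subsingleton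
    exact not_subsingleton M F.surjective_ε.subsingleton

end Ext

end MinimalFreeResolution

/-! ### Finite projective dimension of the residue field. -/

open scoped TensorProduct in
/-- Base change to `R/(x)` does not raise the projective dimension of `M` when `x` is regular
on `M`. -/
lemma hasProjectiveDimensionLE_quotient_tensor {R : Type u} [CommRing R] [IsNoetherianRing R]
    {x : R} (hx : IsSMulRegular R x) (n : ℕ) (M : Type u) [AddCommGroup M] [Module R M]
    [Module.Finite R M] (hM : IsSMulRegular M x)
    (h : HasProjectiveDimensionLE (ModuleCat.of R M) n) :
    HasProjectiveDimensionLE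
      (ModuleCat.of (R ⧸ Ideal.span {x}) ((R ⧸ Ideal.span {x}) ⊗[R] M)) n := by
  induction n generalizing M with
  | zero =>
    rw [← projective_iff_hasProjectiveDimensionLE_zero, ← IsProjective.iff_projective] at h ⊢
    change Module.Projective R M at h
    change Module.Projective (R ⧸ Ideal.span {x}) ((R ⧸ Ideal.span {x}) ⊗[R] M)
    infer_instance
  | succ n ih =>
    obtain ⟨r, f, hf⟩ := Module.Finite.exists_fin' R M
    let R' := R ⧸ Ideal.span {x}
    have : CategoryTheory.Projective f.shortComplexKer.X₂ :=
      (IsProjective.iff_projective (ModuleCat.of R (Fin r → R))).mp inferInstance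
    have hk : HasProjectiveDimensionLE (ModuleCat.of R (LinearMap.ker f)) n :=
      ((LinearMap.shortExact_shortComplexKer hf).hasProjectiveDimensionLT_X₃_iff n this).mp h
    have hreg : IsSMulRegular (LinearMap.ker f) x := fun a b hab ↦ Subtype.ext <| funext fun i ↦
      hx congr($hab.1 i)
    have ih' := ih _ hreg hk
    have hex : Function.Exact (LinearMap.ker f).subtype f := f.exact_subtype_ker_map
    -- This is $\operatorname{Tor}_1(R/(x),M)=0$. Prepending a zero map turns injectivity into
    -- exactness of a four-term sequence whose last term has $x$ regular.
    have hinj : Function.Injective ((LinearMap.ker f).subtype.lTensor R') := by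
      have h0 : Function.Exact (0 : PUnit →ₗ[R] LinearMap.ker f) (LinearMap.ker f).subtype := by
        rw [LinearMap.exact_zero_iff_injective]
        exact Subtype.val_injective
      have h1 := QuotSMulTop.map_first_exact_on_four_term_exact_of_isSMulRegular_last h0 hex hM
      rw [map_zero, LinearMap.exact_zero_iff_injective] at h1
      have h2 := QuotSMulTop.equivQuotTensor_naturality x (LinearMap.ker f).subtype
      have h3 : ⇑((LinearMap.ker f).subtype.lTensor R') =
          QuotSMulTop.equivQuotTensor x _ ∘ QuotSMulTop.map x (LinearMap.ker f).subtype ∘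
            (QuotSMulTop.equivQuotTensor x _).symm := by
        funext z
        have := congr($h2 ((QuotSMulTop.equivQuotTensor x _).symm z))
        simpa using this.symm
      rw [h3]
      exact (LinearEquiv.injective _).comp (h1.comp (LinearEquiv.injective _))
    let S : ShortComplex (ModuleCat.{u} R') := ShortComplex.mk
      (ModuleCat.ofHom ((LinearMap.ker f).subtype.baseChange R'))
      (ModuleCat.ofHom (f.baseChange R')) (by
        rw [← ModuleCat.ofHom_comp, ← LinearMap.baseChange_comp, hex.linearMap_comp_eq_zero,
          LinearMap.baseChange_zero]
        rfl)
    have hS : S.ShortExact :=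
      { exact := (ShortComplex.ShortExact.moduleCat_exact_iff_function_exact S).mpr
          (lTensor_exact R' hex hf)
        mono_f := (ModuleCat.mono_iff_injective _).mpr hinj
        epi_g := (ModuleCat.epi_iff_surjective _).mpr (LinearMap.lTensor_surjective R' hf) }
    have hP : CategoryTheory.Projective S.X₂ :=
      (IsProjective.iff_projective (ModuleCat.of R' (R' ⊗[R] (Fin r → R)))).mp inferInstance
    exact (hS.hasProjectiveDimensionLT_X₃_iff n hP).mpr ih'

namespace IsLocalRing

/-- Over a local ring with nonzero socle, finitely generated modules of finite projective dimension
are projective. -/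
lemma projective_of_hasProjectiveDimensionLE {R : Type u} [CommRing R] [IsLocalRing R]
    [IsNoetherianRing R] {s : R} (hs : s ≠ 0) (hm : ∀ a ∈ maximalIdeal R, a * s = 0) (n : ℕ)
    (M : Type u) [AddCommGroup M] [Module R M] [Module.Finite R M]
    (h : HasProjectiveDimensionLE (ModuleCat.of R M) n) : Module.Projective R M := by
  induction n generalizing M with
  | zero =>
    rwa [← projective_iff_hasProjectiveDimensionLE_zero, ← IsProjective.iff_projective] at h
  | succ n ih =>
    obtain ⟨r, f, hf, hk⟩ := MinimalFreeResolution.exists_minimal_cover R M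
    have : CategoryTheory.Projective f.shortComplexKer.X₂ :=
      (IsProjective.iff_projective (ModuleCat.of R (Fin r → R))).mp inferInstance
    have := ih (LinearMap.ker f)
      (((LinearMap.shortExact_shortComplexKer hf).hasProjectiveDimensionLT_X₃_iff n this).mp h)
    have : Module.Free R (LinearMap.ker f) := Module.free_of_flat_of_isLocalRing
    have hbot : LinearMap.ker f = ⊥ := by
      by_contra! hne
      have : Nontrivial (LinearMap.ker f) := Submodule.nontrivial_iff_ne_bot.mpr hne
      -- A nonzero free module is faithful, yet $s$ kills the kernel because its vectors have
      -- coordinates in $\mathfrak m$.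
      refine hs (FaithfulSMul.eq_of_smul_eq_smul (α := LinearMap.ker f) fun x ↦ ?_)
      ext j
      simpa [mul_comm] using hm _ (hk x.1 x.2 j)
    exact Module.Projective.of_equiv (.ofBijective f ⟨LinearMap.ker_eq_bot.mp hbot, hf⟩)

/-- Otherwise $R$ has nonzero socle, so $k$ would be free, hence faithful, and $\mathfrak m$ would
vanish. -/
lemma maximalIdeal_notMem_associatedPrimes {R : Type u} [CommRing R] [IsLocalRing R]
    [IsNoetherianRing R] (hR : maximalIdeal R ≠ ⊥) {p : ℕ}
    (hp : HasProjectiveDimensionLE (ModuleCat.of R (ResidueField R)) p) :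
    maximalIdeal R ∉ associatedPrimes R R := by
  intro hmem
  rw [AssociatedPrimes.mem_iff, isAssociatedPrime_iff] at hmem
  obtain ⟨hprime, s, hs⟩ := hmem
  have hs0 : s ≠ 0 := by
    rintro rfl
    exact hprime.ne_top (by rw [hs]; simp)
  have hm : ∀ a ∈ maximalIdeal R, a * s = 0 := fun a ha ↦ by
    rw [hs] at ha
    simpa [Submodule.mem_colon_singleton] using ha
  have := projective_of_hasProjectiveDimensionLE hs0 hm p _ hp
  have : Module.Free R (ResidueField R) := Module.free_of_flat_of_isLocalRing
  exact hR ((annihilator_residueField R).symm.trans (annihilator_eq_bot.mpr inferInstance))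

lemma exists_regular_notMem_sq {R : Type u} [CommRing R] [IsLocalRing R]
    [IsNoetherianRing R] (hR : maximalIdeal R ≠ ⊥) {p : ℕ}
    (hp : HasProjectiveDimensionLE (ModuleCat.of R (ResidueField R)) p) :
    ∃ x ∈ maximalIdeal R, x ∉ maximalIdeal R ^ 2 ∧ IsSMulRegular R x := by
  have hsq : maximalIdeal R ≠ maximalIdeal R ^ 2 := fun h ↦ hR <|
    Submodule.eq_bot_of_le_smul_of_le_jacobson_bot _ _ (IsNoetherian.noetherian _)
      (by rw [smul_eq_mul, ← sq]; exact h.le) (maximalIdeal_le_jacobson _)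
  have hlt : maximalIdeal R ^ 2 ≠ ⊤ := fun h ↦
    (maximalIdeal.isMaximal R).ne_top (top_le_iff.mp (h.ge.trans (Ideal.pow_le_self two_ne_zero)))
  -- Prime avoidance for $\mathfrak m^2$ together with the associated primes. It tolerates two
  -- non-prime ideals; $\mathfrak m^2$ fills both slots.
  have hnot := (Ideal.subset_iUnion_iff_mem_of_isMaximal_of_finite (M := maximalIdeal R)
    ((associatedPrimes.finite R R).insert (maximalIdeal R ^ 2)) (maximalIdeal R ^ 2)
    (maximalIdeal R ^ 2) (fun I hI h _ ↦ (hI.resolve_left h).isPrime) hlt hlt).not.mpr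
    (by rintro (h | h)
        · exact hsq h
        · exact maximalIdeal_notMem_associatedPrimes hR hp h)
  obtain ⟨x, hx, hx'⟩ := Set.not_subset.mp hnot
  rw [Set.biUnion_insert, biUnion_associatedPrimes_eq_compl_regular R R] at hx'
  simp only [Set.mem_union, not_or, Set.mem_compl_iff, not_not] at hx'
  exact ⟨x, hx, hx'⟩

open scoped TensorProduct in
/-- The residue field of `R/(x)` is a retract of `𝔪/x𝔪` for `x ∈ 𝔪` outside `𝔪²`. -/
lemma nonempty_retract_residueField {R : Type u} [CommRing R] [IsLocalRing R] {x : R}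
    (hx : x ∈ maximalIdeal R) (hx2 : x ∉ maximalIdeal R ^ 2) [IsLocalRing (R ⧸ Ideal.span {x})] :
    Nonempty (Retract
      (ModuleCat.of (R ⧸ Ideal.span {x}) (ResidueField (R ⧸ Ideal.span {x})))
      (ModuleCat.of (R ⧸ Ideal.span {x}) ((R ⧸ Ideal.span {x}) ⊗[R] maximalIdeal R))) := by
  let R' := R ⧸ Ideal.span {x}
  let K := ResidueField R'
  have hloc : IsLocalHom (algebraMap R R') :=
    IsLocalHom.of_surjective _ Ideal.Quotient.mk_surjective
  let ξ : maximalIdeal R := ⟨x, hx⟩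
  have hξ : (maximalIdeal R).toCotangent ξ ≠ 0 := (Ideal.toCotangent_eq_zero _ _).not.mpr hx2
  -- A functional on $\mathfrak m/\mathfrak m^2$ taking the class of $x$ to $1$ supplies the
  -- retraction; the section sends $1$ to the class of $x$.
  obtain ⟨f, hf⟩ := Module.Projective.exists_dual_eq_one (ResidueField R)
    (V := CotangentSpace R) hξ
  let l : maximalIdeal R →ₗ[R] K :=
    { toFun y := ResidueField.map (algebraMap R R') (f ((maximalIdeal R).toCotangent y))
      map_add' y z := by rw [map_add, map_add, map_add]
      map_smul' a y := by
        rw [map_smul, ← algebraMap_smul (ResidueField R) a, map_smul, smul_eq_mul, map_mul,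
          RingHom.id_apply, Algebra.smul_def]
        rfl }
  have hl : l ξ = 1 := (congrArg (ResidueField.map (algebraMap R R')) hf).trans (map_one _)
  let i₀ : R' →ₗ[R'] R' ⊗[R] maximalIdeal R := LinearMap.toSpanSingleton R' _ (1 ⊗ₜ ξ)
  have hi₀ : LinearMap.ker (Algebra.linearMap R' K) ≤ LinearMap.ker i₀ := by
    intro a ha
    obtain ⟨a, rfl⟩ := Ideal.Quotient.mk_surjective a
    have ha' : a ∈ maximalIdeal R := by
      have : algebraMap R R' a ∈ maximalIdeal R' := (residue_eq_zero_iff _).mp ha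
      rw [mem_maximalIdeal, mem_nonunits_iff] at this ⊢
      exact fun hu ↦ this (hu.map _)
    -- For $a\in\mathfrak m$, $a\cdot x=x\cdot a$ lies in $x\mathfrak m$, so the section descends to
    -- the residue field.
    have : a • ξ = x • (⟨a, ha'⟩ : maximalIdeal R) := Subtype.ext (mul_comm a x)
    rw [LinearMap.mem_ker, LinearMap.toSpanSingleton_apply]
    change algebraMap R R' a • (1 : R') ⊗ₜ[R] ξ = 0
    rw [algebraMap_smul, ← TensorProduct.tmul_smul, this, TensorProduct.tmul_smul,
      TensorProduct.smul_tmul', Algebra.smul_def, mul_one]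
    have : algebraMap R R' x = 0 :=
      Ideal.Quotient.eq_zero_iff_mem.mpr (Ideal.mem_span_singleton_self x)
    rw [this, TensorProduct.zero_tmul]
  obtain ⟨i, hi⟩ := LinearMap.exists_comp_eq_of_ker_le (f := Algebra.linearMap R' K)
    residue_surjective hi₀
  refine ⟨⟨ModuleCat.ofHom i, ModuleCat.ofHom (l.liftBaseChange R'), ?_⟩⟩
  ext c
  obtain ⟨c, rfl⟩ := residue_surjective c
  have : i (residue R' c) = i₀ c := congr($hi c)
  change l.liftBaseChange R' (i (residue R' c)) = residue R' c
  rw [this, LinearMap.toSpanSingleton_apply, map_smul, LinearMap.liftBaseChange_tmul, hl, one_smul,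
    Algebra.smul_def, mul_one]
  rfl

/-- If the residue field has finite projective dimension, then the maximal ideal is generated by
a regular sequence. -/
theorem exists_isWeaklyRegular_ofList_eq_maximalIdeal (n : ℕ) (R : Type u) [CommRing R]
    [IsLocalRing R] [IsNoetherianRing R] (hn : ringKrullDim R ≤ n) (p : ℕ)
    (hp : HasProjectiveDimensionLE (ModuleCat.of R (ResidueField R)) p) :
    ∃ rs : List R, RingTheory.Sequence.IsWeaklyRegular R rs ∧ Ideal.ofList rs = maximalIdeal R := by
  induction n generalizing R p with
  | zero =>
    by_cases hR : maximalIdeal R = ⊥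
    · exact ⟨[], .nil R R, by simp [hR]⟩
    -- In dimension zero a regular $x\in\mathfrak m$ would leave a nonzero quotient of negative
    -- dimension.
    obtain ⟨x, hx, -, hreg⟩ := exists_regular_notMem_sq hR hp
    have hdim := ringKrullDim_quotient_span_singleton_succ_eq_ringKrullDim hreg hx
    have : Nontrivial (R ⧸ Ideal.span {x}) := Ideal.Quotient.nontrivial_iff.mpr <|
      ((Ideal.span_singleton_le_iff_mem _).mpr hx).trans_lt
        (lt_top_iff_ne_top.mpr (maximalIdeal.isMaximal R).ne_top) |>.ne
    have h0 : 0 ≤ ringKrullDim (R ⧸ Ideal.span {x}) := ringKrullDim_nonneg_of_nontrivial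
    have := (add_le_add_left h0 1).trans (hdim.le.trans hn)
    norm_num at this
  | succ n ih =>
    by_cases hR : maximalIdeal R = ⊥
    · exact ⟨[], .nil R R, by simp [hR]⟩
    obtain ⟨x, hx, hx2, hreg⟩ := exists_regular_notMem_sq hR hp
    have hdim := ringKrullDim_quotient_span_singleton_succ_eq_ringKrullDim hreg hx
    let R' := R ⧸ Ideal.span {x}
    have hxm : Ideal.span {x} ≤ maximalIdeal R := (Ideal.span_singleton_le_iff_mem _).mpr hx
    have : Nontrivial R' := Ideal.Quotient.nontrivial_iff.mpr <|
      hxm.trans_lt (lt_top_iff_ne_top.mpr (maximalIdeal.isMaximal R).ne_top) |>.ne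
    have hsurj : Function.Surjective (Ideal.Quotient.mk (Ideal.span {x})) :=
      Ideal.Quotient.mk_surjective
    have : IsLocalRing R' := .of_surjective' _ hsurj
    have : IsLocalHom (Ideal.Quotient.mk (Ideal.span {x})) := .of_surjective _ hsurj
    have hcomap : (maximalIdeal R').comap (Ideal.Quotient.mk (Ideal.span {x})) = maximalIdeal R :=
      ((local_hom_TFAE (Ideal.Quotient.mk (Ideal.span {x}))).out 0 4).mp ‹_›
    have hdim' : ringKrullDim R' ≤ n := by
      rw [← hdim, Nat.cast_succ] at hn
      exact ENat.WithBot.add_le_add_one_right_iff.mp hn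
    have hm : HasProjectiveDimensionLE (ModuleCat.of R (maximalIdeal R)) p := by
      have hs : Function.Surjective (Algebra.linearMap R (ResidueField R)) := residue_surjective
      have hker : LinearMap.ker (Algebra.linearMap R (ResidueField R)) = maximalIdeal R :=
        ker_residue
      have : CategoryTheory.Projective
          (Algebra.linearMap R (ResidueField R)).shortComplexKer.X₂ :=
        (IsProjective.iff_projective (ModuleCat.of R R)).mp inferInstance
      -- The bound on $k$ is weakened by one so that $\mathfrak m$ inherits the same $p$; it need
      -- not drop, since the induction is on dimension.
      have := ((LinearMap.shortExact_shortComplexKer hs).hasProjectiveDimensionLT_X₃_iff p this).mp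
        (hasProjectiveDimensionLT_of_ge _ (p + 1) (p + 2) (Nat.le_succ _))
      rwa [← hker]
    have hregm : IsSMulRegular (maximalIdeal R) x := fun a b hab ↦ Subtype.ext (hreg congr($hab.1))
    have := hasProjectiveDimensionLE_quotient_tensor hreg p (maximalIdeal R) hregm hm
    obtain ⟨ret⟩ := nonempty_retract_residueField hx hx2
    obtain ⟨rs', hrs', hm'⟩ := ih R' hdim' p (ret.hasProjectiveDimensionLT (p + 1))
    obtain ⟨rs, rfl⟩ := List.map_surjective_iff.mpr hsurj rs'
    refine ⟨x :: rs, .cons hreg ?_, ?_⟩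
    · have h1 := (RingTheory.Sequence.isWeaklyRegular_map_algebraMap_iff R' R' rs).mp hrs'
      refine (LinearEquiv.isWeaklyRegular_congr (Submodule.quotEquivOfEq _ _ ?_) rs).mp h1
      simp [← Submodule.ideal_span_singleton_smul]
    · rw [← Ideal.map_ofList] at hm'
      rw [Ideal.ofList_cons, sup_comm]
      have := congrArg (Ideal.comap (Ideal.Quotient.mk (Ideal.span {x}))) hm'
      rwa [Ideal.comap_map_of_surjective _ hsurj, ← RingHom.ker_eq_comap_bot, Ideal.mk_ker,
        hcomap] at this

end IsLocalRing

/-! ### Maximal ideals generated by a regular sequence. -/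

namespace IsLocalRing

variable {R : Type u} [CommRing R] [IsLocalRing R] {rs : List R}

lemma isRegular_of_ofList_eq_maximalIdeal (hreg : RingTheory.Sequence.IsWeaklyRegular R rs)
    (hrs : Ideal.ofList rs = maximalIdeal R) : RingTheory.Sequence.IsRegular R rs :=
  RingTheory.Sequence.IsRegular.of_isWeaklyRegular_of_mem_maximalIdeal R
    (fun _ hr ↦ hrs ▸ Ideal.subset_span hr) hreg

lemma length_le_depth (hreg : RingTheory.Sequence.IsWeaklyRegular R rs)
    (hrs : Ideal.ofList rs = maximalIdeal R) : (rs.length : ℕ∞) ≤ depth R :=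
  le_iSup₂ (f := fun (rs : List R) (_ : (∀ r ∈ rs, r ∈ maximalIdeal R) ∧
      RingTheory.Sequence.IsRegular R rs) ↦ (rs.length : ℕ∞)) rs
    ⟨fun _ hr ↦ hrs ▸ Ideal.subset_span hr, isRegular_of_ofList_eq_maximalIdeal hreg hrs⟩

variable [IsNoetherianRing R]

/-- A Noetherian local ring is regular if its maximal ideal is generated by a regular sequence. -/
lemma isRegularLocalRing_of_ofList_eq_maximalIdeal
    (hreg : RingTheory.Sequence.IsWeaklyRegular R rs) (hrs : Ideal.ofList rs = maximalIdeal R) :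
    IsRegularLocalRing R := by
  classical
  refine .of_spanFinrank_maximalIdeal_le R ?_
  have hdim := ringKrullDim_add_length_eq_ringKrullDim_of_isRegular rs
    (isRegular_of_ofList_eq_maximalIdeal hreg hrs)
  have : Nontrivial (R ⧸ Ideal.ofList rs) :=
    Ideal.Quotient.nontrivial_iff.mpr (hrs ▸ (maximalIdeal.isMaximal R).ne_top)
  have h0 : 0 ≤ ringKrullDim (R ⧸ Ideal.ofList rs) := ringKrullDim_nonneg_of_nontrivial
  have hle : (maximalIdeal R).spanFinrank ≤ rs.length := by
    have h1 : (maximalIdeal R).spanFinrank ≤ (rs.toFinset : Set R).ncard := by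
      rw [← hrs, show Ideal.ofList rs = Ideal.span (rs.toFinset : Set R) by simp [Ideal.ofList]]
      exact Submodule.spanFinrank_span_le_ncard_of_finite (Finset.finite_toSet _)
    rw [Set.ncard_coe_finset] at h1
    exact h1.trans rs.toFinset_card_le
  calc ((maximalIdeal R).spanFinrank : WithBot ℕ∞) ≤ rs.length := by exact_mod_cast hle
    _ ≤ ringKrullDim (R ⧸ Ideal.ofList rs) + rs.length := le_add_of_nonneg_left h0
    _ = ringKrullDim R := hdim

lemma projectiveDimension_residueField (hreg : RingTheory.Sequence.IsWeaklyRegular R rs)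
    (hrs : Ideal.ofList rs = maximalIdeal R) :
    projectiveDimension (ModuleCat.of R (ResidueField R)) = rs.length := by
  have h := ModuleCat.projectiveDimension_quotient_eq_length.{u} rs
    (isRegular_of_ofList_eq_maximalIdeal hreg hrs)
  rw [← h]
  let e : ResidueField R ≃ₗ[R] R ⧸ Ideal.ofList rs := Submodule.quotEquivOfEq _ _ hrs.symm
  exact projectiveDimension_eq_of_iso (e ≪≫ₗ (Shrink.linearEquiv.{u} R _).symm).toModuleIso

end IsLocalRing

/-! ### Projective dimension and grade from the resolution. -/

namespace MinimalFreeResolution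

variable {R : Type u} [CommRing R] [IsLocalRing R] {M : Type u} [AddCommGroup M] [Module R M]
  (F : MinimalFreeResolution R M)

lemma hasProjectiveDimensionLE_syzygy_succ_iff (n q : ℕ) :
    HasProjectiveDimensionLE (F.syzygy (n + 1)) q ↔
      HasProjectiveDimensionLE (F.syzygy n) (q + 1) := by
  have hP : CategoryTheory.Projective (F.cover n).shortComplexKer.X₂ :=
    (IsProjective.iff_projective (ModuleCat.of R (Fin (F.rank n) → R))).mp inferInstance
  refine Iff.trans ?_ ((LinearMap.shortExact_shortComplexKer
    (F.cover_surjective n)).hasProjectiveDimensionLT_X₃_iff q hP).symm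
  change _ ↔ HasProjectiveDimensionLT (ModuleCat.of R (LinearMap.ker (F.cover n))) (q + 1)
  rw [F.ker_cover n]
  rfl

lemma hasProjectiveDimensionLE_syzygy_iff (n q : ℕ) :
    HasProjectiveDimensionLE (F.syzygy n) q ↔
      HasProjectiveDimensionLE (ModuleCat.of R M) (q + n) := by
  induction n generalizing q with
  | zero => rfl
  | succ n ih =>
    rw [hasProjectiveDimensionLE_syzygy_succ_iff, ih, show q + 1 + n = q + (n + 1) by omega]

lemma hasProjectiveDimensionLE_of_injective {n : ℕ} (hd : Function.Injective (F.d n)) :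
    HasProjectiveDimensionLE (ModuleCat.of R M) (n + 1) := by
  rw [← Nat.zero_add (n + 1), ← F.hasProjectiveDimensionLE_syzygy_iff,
    ← projective_iff_hasProjectiveDimensionLE_zero, ← IsProjective.iff_projective]
  exact Module.Projective.of_equiv (LinearEquiv.ofInjective (F.d n) hd)

/-- A projective $\Omega^n$ is its own minimal cover, which forces `F.d n` to vanish; injectivity on
a nonzero free module forbids this. -/
lemma not_hasProjectiveDimensionLE [Module.Finite R M] {n : ℕ} (hd : Function.Injective (F.d n))
    (hr : F.rank (n + 1) ≠ 0) : ¬ HasProjectiveDimensionLE (ModuleCat.of R M) n := by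
  intro h
  rw [← Nat.zero_add n, ← F.hasProjectiveDimensionLE_syzygy_iff,
    ← projective_iff_hasProjectiveDimensionLE_zero, ← IsProjective.iff_projective] at h
  have : Module.Finite R (F.syzygy n) := Module.Finite.of_surjective _ (F.cover_surjective n)
  obtain ⟨φ, hφ⟩ := exists_equiv_of_minimal_covers (g := LinearMap.id) (F.cover_surjective n)
    Function.surjective_id (F.ker_cover_le n) (LinearMap.ker_id.trans_le bot_le) (.refl R _)
  have hinj : Function.Injective (F.cover n) := fun x y hxy ↦ φ.injective <|
    (hφ x).trans ((congrArg _ hxy).trans (hφ y).symm)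
  have hbot : LinearMap.range (F.d n) = ⊥ := by
    rw [← F.ker_cover n, LinearMap.ker_eq_bot.mpr hinj]
  let x : Fin (F.rank (n + 1)) → R := Pi.single ⟨0, Nat.pos_of_ne_zero hr⟩ 1
  have hx : F.d n x ∈ LinearMap.range (F.d n) := ⟨x, rfl⟩
  rw [hbot, Submodule.mem_bot, map_eq_zero_iff _ hd] at hx
  simpa [x] using congr_fun hx ⟨0, Nat.pos_of_ne_zero hr⟩

/-- The grade of a module is at most the length of its minimal free resolution. -/
lemma le_of_injective {t : ℕ}
    (h : ∀ j < t, Subsingleton (Ext (ModuleCat.of R M) (ModuleCat.of R R) j)) {n : ℕ}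
    (hd : Function.Injective (F.d n)) (hr : F.rank (n + 1) ≠ 0) : t ≤ n + 1 := by
  by_contra! hlt
  let j : Fin (F.rank (n + 1)) := ⟨0, Nat.pos_of_ne_zero hr⟩
  -- Since `F.d (n + 1)` is zero, a coordinate functional is a cocycle and factors through `F.d n`.
  -- Its value $1$ on a basis vector would then lie in $\mathfrak m$.
  obtain ⟨g, hg⟩ := F.exists_eq_comp_d h hlt (LinearMap.proj j) <| LinearMap.ext fun x ↦ by
    have : F.d (n + 1) x = 0 := hd <| by
      rw [(F.exact_succ n).apply_apply_eq_zero, map_zero]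
    simp [this]
  obtain ⟨v, hv⟩ := LinearMap.exists_eq_dotProduct g
  have h1 : g (F.d n (Pi.single j 1)) = 1 := by
    simpa using congr($hg (Pi.single j 1))
  rw [hv] at h1
  exact (Ideal.ne_top_iff_one _).mp (maximalIdeal.isMaximal R).ne_top
    (h1 ▸ F.dotProduct_d_mem n v _)

end MinimalFreeResolution

theorem theorem1p1 {R : Type u} [CommRing R] [IsLocalRing R] [IsNoetherianRing R]
    (t : ℕ) (ht : 3 ≤ t) (hdepth : IsLocalRing.depth R = t)
    (F : MinimalFreeResolution R (ResidueField R)) :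
    (∀ i : ℕ, 2 ≤ i → i ≤ t - 1 → Module.IsReflexive R (F.syzygy i)) ∧
    (∀ i : ℕ, 2 ≤ i → i ≤ t - 1 → Module.IsSelfDual R (F.syzygy i) →
      IsRegularLocalRing R ∧ Odd t ∧ t = 2 * i - 1) := by
  have hext : ∀ j < t, Subsingleton
      (Ext (ModuleCat.of R (ResidueField R)) (ModuleCat.of R R) j) :=
    fun j hj ↦ subsingleton_ext_residueField hdepth.ge hj
  refine ⟨fun i hi hit ↦ ?_, fun i hi hit hself ↦ ?_⟩
  · obtain ⟨b, rfl⟩ := Nat.exists_eq_add_of_le' hi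
    exact F.isReflexive_syzygy hext (by omega)
  · obtain ⟨m, rfl⟩ := Nat.exists_eq_add_of_le' (one_le_two.trans hi)
    obtain ⟨hinj, hrank⟩ := F.d_injective_of_isSelfDual hext (by omega) hself
    have hpd := F.hasProjectiveDimensionLE_of_injective hinj
    have hnpd := F.not_hasProjectiveDimensionLE hinj hrank
    have hle := F.le_of_injective hext hinj hrank
    obtain ⟨n, hn⟩ : ∃ n : ℕ, ringKrullDim R ≤ n :=
      ⟨_, ringKrullDim_le_spanFinrank_maximalIdeal R⟩
    obtain ⟨rs, hreg, hrs⟩ := exists_isWeaklyRegular_ofList_eq_maximalIdeal n R hn _ hpd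
    have hlen := length_le_depth hreg hrs
    rw [hdepth, Nat.cast_le] at hlen
    rw [← projectiveDimension_le_iff, projectiveDimension_residueField hreg hrs] at hnpd
    -- With $i=m+1$, the chain $2m+1\le$ `rs.length` $\le t\le 2m+1$ closes.
    have hge : ¬ rs.length ≤ 2 * m := fun h ↦ hnpd (by exact_mod_cast h)
    exact ⟨isRegularLocalRing_of_ofList_eq_maximalIdeal hreg hrs, ⟨m, by omega⟩, by omega⟩
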